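/- For a positive integer $k$ and $a\in\mathbb Z_k=\mathbb Z/k\mathbb Z$, let $|a|'$ denote the cyclic distance of $a$ from $0$ in $\mathbb Z_k$. For $x\in\mathbb Z_k^n$ let $\|x\|_1=\frac1n\sum_{i=1}^n|x_i|'$. For $\alpha\in\mathbb R$, a function $f:\mathbb Z_k^n\to\mathbb Z_l^m$ is called $\alpha$-Lipschitz with respect to the $L^1$-norm if $\|f(x)-f(y)\|_1\le\alpha\|x-y\|_1$ for all $x,y\in\mathbb Z_k^n$. Two functions $g,h:\mathbb Z_k^n\to\mathbb Z_l$ are called $\epsilon$-close if $\frac1{k^n}\sum_{x\in\mathbb Z_k^n}|g(x)-h(x)|'\le\epsilon$. A function $g$ of $n$ coordinates is called an $M$-junta if there is a set $J\subset\{1,\dots,n\}$ with $|J|=M$ such that $g(x)$ depends only upon the values $(x_j)_{j\in J}$. **Theorem 1.7.** There is an absolute constant $C_2>0$ with the following property. Let $k,l$ be positive integers, let $n,m$ be non-negative integers, let $\alpha\in\mathbb R$, and suppose that $f=(f_1,\dots,f_m):\mathbb Z_k^n\to\mathbb Z_l^m$ is $\alpha$-Lipschitz with respect to the $L^1$-norm.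 Then for any $\delta,\epsilon>0$ there is a non-negative integer $$M\le l\exp\left(\frac{C_2\,\alpha k}{\delta\epsilon}\right)$$ such that, for at least $(1-\delta)m$ coordinates $i\in\{1,\dots,m\}$, the function $f_i$ is $\epsilon$-close to some $M$-junta $g_i:\mathbb Z_k^n\to\mathbb Z_l$. In fact, one can take $C_2=4C_1$ for every real constant $C_1$ for which the following junta theorem for the $\ell^1$-grid holds: for all positive integers $k,n$, all $A\subset\{1,\dots,k\}^n$ and all $\epsilon>0$, there is an $M$-junta $g:\{1,\dots,k\}^n\to\{0,1\}$ with $\frac1{k^n}\sum_x|1_A(x)-g(x)|\le\epsilon$ and $M\le\exp\left(C_1|\partial A|/(k^{n-1}\epsilon)\right)$. Here $\partial A$ is the set of edges joining a point of $A$ to a point outside $A$ in the graph on $\{1,\dots,k\}^n$ in which two points are adjacent if and only if they differ in exactly one coordinate, and by exactly $1$ in that coordinate. -/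

import Mathlib

/-- The cyclic distance from `0` of an element of `ℤ/kℤ`. -/
def cyclicAbs {k : ℕ} (a : ZMod k) : ℕ := min a.val (k - a.val)

/-- The normalised `L¹`-norm on the discrete torus `(ℤ/kℤ)ⁿ`. -/
noncomputable def torusNorm {k n : ℕ} (x : Fin n → ZMod k) : ℝ :=
  (1 / (n : ℝ)) * ∑ i, (cyclicAbs (x i) : ℝ)

/-- `f` is `α`-Lipschitz for the normalised `L¹`-norms. -/
def IsTorusLipschitz {k l n m : ℕ} (α : ℝ) (f : (Fin n → ZMod k) → (Fin m → ZMod l)) : Prop :=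
  ∀ x y, torusNorm (f x - f y) ≤ α * torusNorm (x - y)

/-- The `L¹`-distance of two functions from the torus to `ℤ/lℤ`: the average over the torus of
the cyclic distance of their values. -/
noncomputable def cyclicL1Dist {k l n : ℕ} [NeZero k] (f g : (Fin n → ZMod k) → ZMod l) : ℝ :=
  (1 / (k : ℝ) ^ n) * ∑ x, (cyclicAbs (f x - g x) : ℝ)

/-- `g` is an `M`-junta: for some set `J` of `M` coordinates, `g x` depends only upon the values
`x j` with `j ∈ J`. -/
def IsJunta {n : ℕ} {X Y : Type*} (M : ℕ) (g : (Fin n → X) → Y) : Prop :=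
  ∃ J : Finset (Fin n), J.card = M ∧ DependsOn g (J : Set (Fin n))

/-- The constant `C` is admissible in the structure theorem for Lipschitz maps between discrete
tori. -/
def IsTorusLipschitzConstant (C : ℝ) : Prop :=
  ∀ (k l n m : ℕ) [NeZero k] [NeZero l] (α : ℝ) (f : (Fin n → ZMod k) → (Fin m → ZMod l)),
    IsTorusLipschitz α f →
    ∀ δ ε : ℝ, 0 < δ → 0 < ε →
    ∃ M : ℕ, (M : ℝ) ≤ l * Real.exp (C * α * k / (δ * ε)) ∧
      (1 - δ) * (m : ℝ) ≤
        ({i : Fin m | ∃ g : (Fin n → ZMod k) → ZMod l,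
          IsJunta M g ∧ cyclicL1Dist (fun x => f x i) g ≤ ε}.ncard : ℝ)

/-- The `ℓ¹`-grid graph on `[k]ⁿ`. -/
def gridGraph (k n : ℕ) : SimpleGraph (Fin n → Fin k) where
  Adj x y := ∃ j, |((x j : ℕ) : ℤ) - ((y j : ℕ) : ℤ)| = 1 ∧ ∀ i, i ≠ j → x i = y i
  symm := ⟨fun x y ⟨j, h, h'⟩ => ⟨j, by rw [abs_sub_comm]; exact h, fun i hi => (h' i hi).symm⟩⟩
  loopless := ⟨fun x ⟨j, h, _⟩ => by simp at h⟩

/-- The edge-boundary of `A` in the grid: the edges joining a point of `A` to a point outside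
`A`. -/
def gridBoundary {k n : ℕ} (A : Set (Fin n → Fin k)) : Set (Sym2 (Fin n → Fin k)) :=
  {e | ∃ x ∈ A, ∃ y ∉ A, (gridGraph k n).Adj x y ∧ e = s(x, y)}

/-- The normalised `L¹`-norm of a real-valued function on `[k]ⁿ`. -/
noncomputable def gridL1Norm {k n : ℕ} (h : (Fin n → Fin k) → ℝ) : ℝ :=
  (1 / (k : ℝ) ^ n) * ∑ x, |h x|

/-- The constant `C` is admissible in the junta theorem for the `ℓ¹`-grid: the indicator function
of every `A ⊆ [k]ⁿ` is, for every `ε > 0`, `ε`-close to some `{0,1}`-valued `M`-junta with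
`M ≤ exp (C |∂A| / (kⁿ⁻¹ ε))`. -/
def IsGridJuntaConstant (C : ℝ) : Prop :=
  ∀ (k n : ℕ) [NeZero k] [NeZero n] (A : Set (Fin n → Fin k)) (ε : ℝ), 0 < ε →
    ∃ (M : ℕ) (g : (Fin n → Fin k) → ℝ), (∀ x, g x = 0 ∨ g x = 1) ∧ IsJunta M g ∧
      gridL1Norm (fun x => A.indicator 1 x - g x) ≤ ε ∧
      (M : ℝ) ≤ Real.exp (C * (gridBoundary A).ncard / ((k : ℝ) ^ (n - 1) * ε))

open Finset BigOperators

/-! ### Elementary inequalities -/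

theorem sub_le_mul_log {a y : ℝ} (ha : 0 ≤ a) (hy : 0 < y) :
    a * Real.log a ≤ a * Real.log y + (a ^ 2 / y - a) := by
  rcases ha.eq_or_lt with rfl | ha
  · simp
  have h := Real.log_le_sub_one_of_pos (div_pos ha hy)
  rw [Real.log_div ha.ne' hy.ne'] at h
  have h2 := mul_le_mul_of_nonneg_left h ha.le
  have h3 : a * (a / y - 1) = a ^ 2 / y - a := by ring
  linarith

theorem two_point_entropy {a b : ℝ} (ha : 0 ≤ a) (hb : 0 ≤ b) :
    (a * Real.log a + b * Real.log b) / 2 - (a + b) / 2 * Real.log ((a + b) / 2) ≤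
      (√a - √b) ^ 2 := by
  rcases (add_nonneg ha hb).eq_or_lt with h | h
  · have : a = 0 := by linarith
    have : b = 0 := by linarith
    subst_vars; simp
  have hy : 0 < (a + b) / 2 := by linarith
  have h1 := sub_le_mul_log ha hy
  have h2 := sub_le_mul_log hb hy
  have h3 : ((a ^ 2 / ((a + b) / 2) - a) + (b ^ 2 / ((a + b) / 2) - b)) / 2 ≤ (√a - √b) ^ 2 := by
    have e : ((a ^ 2 / ((a + b) / 2) - a) + (b ^ 2 / ((a + b) / 2) - b)) / 2
        = (a - b) ^ 2 / (2 * (a + b)) := by field_simp; ring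
    rw [e, div_le_iff₀ (by linarith)]
    have e2 : a - b = (√a - √b) * (√a + √b) := by
      nlinarith [Real.sq_sqrt ha, Real.sq_sqrt hb]
    rw [e2, mul_pow]
    apply mul_le_mul_of_nonneg_left _ (sq_nonneg _)
    nlinarith [Real.sq_sqrt ha, Real.sq_sqrt hb, sq_nonneg (√a - √b)]
  linarith

theorem mul_log_le_of_le_two_mul {a y : ℝ} (ha : 0 ≤ a) (h : a ≤ 2 * y) :
    a * Real.log a ≤ a * Real.log y + (a - y) + 6 * (√a - √y) ^ 2 := by
  rcases (show 0 ≤ y by linarith).eq_or_lt with rfl | hy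
  · have : a = 0 := by linarith
    simp [this]
  have h1 := sub_le_mul_log ha hy
  have h3 : a ^ 2 / y - a - (a - y) ≤ 6 * (√a - √y) ^ 2 := by
    have e : a ^ 2 / y - a - (a - y) = (a - y) ^ 2 / y := by field_simp
    rw [e, div_le_iff₀ hy]
    have e2 : a - y = (√a - √y) * (√a + √y) := by
      nlinarith [Real.sq_sqrt ha, Real.sq_sqrt hy.le]
    rw [e2, mul_pow, mul_comm 6, mul_assoc]
    apply mul_le_mul_of_nonneg_left _ (sq_nonneg _)
    nlinarith [Real.sq_sqrt ha, Real.sq_sqrt hy.le, sq_nonneg (√a - √y)]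
  linarith

/-- The reverse triangle inequality in `L²` of a finite uniform probability space. -/
theorem sq_sqrt_expect_sub_le {σ : Type*} (s : Finset σ) (a b : σ → ℝ) :
    (√(𝔼 i ∈ s, a i ^ 2) - √(𝔼 i ∈ s, b i ^ 2)) ^ 2 ≤ 𝔼 i ∈ s, (a i - b i) ^ 2 := by
  have ha : 0 ≤ 𝔼 i ∈ s, a i ^ 2 := expect_nonneg fun i _ => sq_nonneg _
  have hb : 0 ≤ 𝔼 i ∈ s, b i ^ 2 := expect_nonneg fun i _ => sq_nonneg _
  have cs : (𝔼 i ∈ s, a i * b i) ≤ √(𝔼 i ∈ s, a i ^ 2) * √(𝔼 i ∈ s, b i ^ 2) := by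
    rw [← Real.sqrt_mul ha]
    apply Real.le_sqrt_of_sq_le
    simp only [expect_eq_sum_div_card]
    rw [div_pow, div_mul_div_comm, ← sq]
    exact div_le_div_of_nonneg_right (sum_mul_sq_le_sq_mul_sq s a b) (sq_nonneg _)
  have e : 𝔼 i ∈ s, (a i - b i) ^ 2
      = 𝔼 i ∈ s, a i ^ 2 - 2 * (𝔼 i ∈ s, a i * b i) + 𝔼 i ∈ s, b i ^ 2 := by
    rw [mul_expect, ← expect_sub_distrib, ← expect_add_distrib]
    exact expect_congr rfl fun i _ => by ring
  rw [e]
  nlinarith [Real.sq_sqrt ha, Real.sq_sqrt hb]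

theorem expect_add_right {G : Type*} [AddGroup G] [Fintype G] (u : G → ℝ) (h : G) :
    𝔼 x, u (x + h) = 𝔼 x, u x :=
  Fintype.expect_equiv (Equiv.addRight h) _ _ fun _ => rfl

/-- The mean square increment of `g` under the shift by `h`. -/
noncomputable def shiftEnergy {G : Type*} [AddGroup G] [Fintype G] (h : G) (g : G → ℝ) : ℝ :=
  𝔼 x, (g x - g (x + h)) ^ 2

theorem shiftEnergy_nonneg {G : Type*} [AddGroup G] [Fintype G] (h : G) (g : G → ℝ) :
    0 ≤ shiftEnergy h g := expect_nonneg fun _ _ => sq_nonneg _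

/-- The quadratic mean of translates does not increase the mean square increments. -/
theorem shiftEnergy_sqrt_expect_le {G σ : Type*} [AddCommGroup G] [Fintype G] (s : Finset σ)
    (hs : s.Nonempty) (a : σ → G) (h : G) (g : G → ℝ) :
    shiftEnergy h (fun x => √(𝔼 i ∈ s, g (x + a i) ^ 2)) ≤ shiftEnergy h g := by
  unfold shiftEnergy
  calc _ ≤ 𝔼 x, 𝔼 i ∈ s, (g (x + a i) - g (x + a i + h)) ^ 2 := by
        refine expect_le_expect fun x _ => ?_
        refine (sq_sqrt_expect_sub_le s _ _).trans (le_of_eq ?_)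
        exact expect_congr rfl fun i _ => by rw [add_right_comm]
    _ = 𝔼 i ∈ s, 𝔼 x, (g (x + a i) - g (x + a i + h)) ^ 2 := expect_comm _ _ _
    _ = 𝔼 i ∈ s, 𝔼 x, (g x - g (x + h)) ^ 2 :=
        expect_congr rfl fun i _ => expect_add_right (fun x => (g x - g (x + h)) ^ 2) (a i)
    _ = _ := expect_const hs _

/-- Averaging a density with a translate of it decreases the entropy in a controlled way. -/
theorem expect_mul_log_le_pair {G : Type*} [AddGroup G] [Fintype G] (X : G → ℝ)
    (hX : ∀ x, 0 ≤ X x) (h : G) :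
    𝔼 x, X x * Real.log (X x) ≤
      (𝔼 x, (X x + X (x + h)) / 2 * Real.log ((X x + X (x + h)) / 2)) +
        shiftEnergy h (fun x => √(X x)) := by
  have e : 𝔼 x, X x * Real.log (X x) =
      𝔼 x, (X x * Real.log (X x) + X (x + h) * Real.log (X (x + h))) / 2 := by
    rw [← expect_div, expect_add_distrib,
      expect_add_right (fun x => X x * Real.log (X x)) h]
    ring
  rw [e, shiftEnergy, ← expect_add_distrib]
  refine expect_le_expect fun x _ => ?_
  have := two_point_entropy (hX x) (hX (x + h))
  linarith

/-- The entropy of a square in terms of the first two moments. -/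
theorem le_entropy_sq {G : Type*} [Fintype G] [Nonempty G] (d : G → ℝ) {a L : ℝ}
    (ha : 𝔼 x, |d x| ≤ a) (hL : 0 < L) :
    (𝔼 x, d x ^ 2) * (1 + Real.log L) - L * a ^ 2 ≤
      (𝔼 x, d x ^ 2 * Real.log (d x ^ 2)) - (𝔼 x, d x ^ 2) * Real.log (𝔼 x, d x ^ 2) := by
  set v := 𝔼 x, d x ^ 2 with hv
  set b := 𝔼 x, |d x| with hb
  have hv0 : 0 ≤ v := expect_nonneg fun _ _ => sq_nonneg _
  have hb0 : 0 ≤ b := expect_nonneg fun _ _ => abs_nonneg _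
  have hab : L * b ^ 2 ≤ L * a ^ 2 := by gcongr
  rcases hv0.eq_or_lt with h0 | hvp
  · have hz : ∀ x, d x ^ 2 = 0 := by
      intro x
      have := (expect_eq_zero_iff_of_nonneg (s := (univ : Finset G))
        (fun i _ => sq_nonneg (d i))).1 (hv.symm.trans h0.symm)
      exact this x (mem_univ x)
    simp only [hz, ← h0]
    simp
    positivity
  have hbp : 0 < b := by
    rcases hb0.eq_or_lt with h | h
    · exfalso
      have := (expect_eq_zero_iff_of_nonneg (s := (univ : Finset G))
        (fun i _ => abs_nonneg (d i))).1 (hb.symm.trans h.symm)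
      have hz : ∀ x, d x = 0 := fun x => abs_eq_zero.1 (this x (mem_univ x))
      simp [hv, hz] at hvp
    · exact h
  have hc : 0 < v / b := div_pos hvp hbp
  have key : ∀ x, 2 * Real.log (v / b) * d x ^ 2 + 2 * d x ^ 2 - 2 * (v / b) * |d x| ≤
      d x ^ 2 * Real.log (d x ^ 2) := by
    intro x
    rcases eq_or_ne (d x) 0 with h | h
    · simp [h]
    have hp : 0 < |d x| := abs_pos.2 h
    have h1 := Real.log_le_sub_one_of_pos (div_pos hc hp)
    rw [Real.log_div hc.ne' hp.ne'] at h1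
    rw [← sq_abs (d x), Real.log_pow]
    have h2 := mul_le_mul_of_nonneg_left h1 (sq_nonneg |d x|)
    have h3 : |d x| ^ 2 * (v / b / |d x| - 1) = v / b * |d x| - |d x| ^ 2 := by field_simp
    push_cast
    nlinarith
  have h4 : 2 * Real.log (v / b) * v + 2 * v - 2 * (v / b) * b ≤
      𝔼 x, d x ^ 2 * Real.log (d x ^ 2) := by
    calc _ = 𝔼 x, (2 * Real.log (v / b) * d x ^ 2 + 2 * d x ^ 2 - 2 * (v / b) * |d x|) := by
          rw [expect_sub_distrib, expect_add_distrib, ← mul_expect, ← mul_expect, ← mul_expect]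
      _ ≤ _ := expect_le_expect fun x _ => key x
  have h5 : v / b * b = v := by field_simp
  rw [Real.log_div hvp.ne' hbp.ne'] at h4
  have h6 := Real.log_le_sub_one_of_pos (show 0 < L * b ^ 2 / v by positivity)
  rw [Real.log_div (by positivity) hvp.ne', Real.log_mul hL.ne' (by positivity),
    Real.log_pow] at h6
  have h7 := mul_le_mul_of_nonneg_left h6 hv0
  have h8 : v * (L * b ^ 2 / v - 1) = L * b ^ 2 - v := by field_simp
  push_cast at h7
  nlinarith

/-- A function which is invariant under shifts of the coordinates outside `J` depends only
upon the coordinates in `J`. -/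
theorem dependsOn_of_forall_add_single {ι K β : Type*} [Fintype ι] [DecidableEq ι]
    [AddCommGroup K] (v : (ι → K) → β) (J : Finset ι)
    (hv : ∀ j ∉ J, ∀ x h, v (x + Pi.single j h) = v x) : DependsOn v (J : Set ι) := by
  have key : ∀ (S : Finset ι), Disjoint S J → ∀ x h : ι → K,
      v (x + ∑ j ∈ S, Pi.single j (h j)) = v x := by
    intro S
    induction S using Finset.induction_on with
    | empty => simp
    | insert j S hj ih =>
      intro hd x h
      rw [disjoint_insert_left] at hd
      rw [sum_insert hj, add_comm _ (∑ i ∈ S, _), ← add_assoc, hv j hd.1, ih hd.2]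
  intro x y hxy
  have h := key (univ \ J) sdiff_disjoint x (y - x)
  rw [← h]
  congr 1
  funext i
  rw [Pi.add_apply, Finset.sum_apply]
  by_cases hi : i ∈ J
  · rw [sum_eq_zero, add_zero, hxy i (by exact_mod_cast hi)]
    intro j hj
    have : i ≠ j := fun h => (mem_sdiff.1 hj).2 (h ▸ hi)
    rw [Pi.single_eq_of_ne this]
  · rw [sum_eq_single_of_mem i (by simp [hi])]
    · simp
    · intro j _ hj
      rw [Pi.single_eq_of_ne hj.symm]

/-! ### Averages over coordinate lines -/

section LineAverages

variable {ι K : Type*} [DecidableEq ι] [AddCommGroup K] [Fintype K]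

/-- The average of `u` over the line through `x` in direction `j`. -/
noncomputable def lineAvg (j : ι) (u : (ι → K) → ℝ) (x : ι → K) : ℝ :=
  𝔼 h : K, u (x + Pi.single j h)

/-- The average of `u` over the coordinates in a list. -/
noncomputable def listAvg (l : List ι) (u : (ι → K) → ℝ) : (ι → K) → ℝ := l.foldr lineAvg u

theorem lineAvg_nonneg (j : ι) {u : (ι → K) → ℝ} (hu : ∀ x, 0 ≤ u x) (x : ι → K) :
    0 ≤ lineAvg j u x := expect_nonneg fun _ _ => hu _

theorem lineAvg_comp_add (j : ι) (u : (ι → K) → ℝ) (h x : ι → K) :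
    lineAvg j (fun x => u (x + h)) x = lineAvg j u (x + h) :=
  expect_congr rfl fun i _ => by rw [add_right_comm]

theorem lineAvg_add_single (j : ι) (u : (ι → K) → ℝ) (h : K) (x : ι → K) :
    lineAvg j u (x + Pi.single j h) = lineAvg j u x := by
  unfold lineAvg
  refine Eq.trans ?_ (expect_add_right (fun i : K => u (x + Pi.single j i)) h)
  refine expect_congr rfl fun i _ => ?_
  rw [add_assoc, ← Pi.single_add, add_comm h]

theorem lineAvg_mul (j : ι) (u v : (ι → K) → ℝ) (hv : ∀ x h, v (x + Pi.single j h) = v x)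
    (x : ι → K) : lineAvg j (fun x => u x * v x) x = lineAvg j u x * v x := by
  unfold lineAvg
  rw [expect_mul]
  exact expect_congr rfl fun i _ => by simp only [hv]

theorem lineAvg_sub (j : ι) (u v : (ι → K) → ℝ) (x : ι → K) :
    lineAvg j (fun x => u x - v x) x = lineAvg j u x - lineAvg j v x :=
  expect_sub_distrib _ _ _

theorem listAvg_cons (j : ι) (l : List ι) (u : (ι → K) → ℝ) :
    listAvg (j :: l) u = lineAvg j (listAvg l u) := rfl

theorem listAvg_add_single {j : ι} {l : List ι} (hj : j ∈ l) (u : (ι → K) → ℝ) (h : K)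
    (x : ι → K) : listAvg l u (x + Pi.single j h) = listAvg l u x := by
  induction l generalizing x with
  | nil => simp at hj
  | cons i l ih =>
    rw [listAvg_cons]
    by_cases hl : j ∈ l
    · rw [← lineAvg_comp_add]
      congr 1
      funext y
      exact ih hl y
    · obtain rfl : j = i := by simpa [hl] using hj
      exact lineAvg_add_single _ _ _ _

theorem listAvg_nonneg (l : List ι) {u : (ι → K) → ℝ} (hu : ∀ x, 0 ≤ u x) (x : ι → K) :
    0 ≤ listAvg l u x := by
  induction l generalizing x with
  | nil => exact hu x
  | cons j l ih => exact lineAvg_nonneg j ih x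

theorem listAvg_le_one (l : List ι) {u : (ι → K) → ℝ} (hu : ∀ x, u x ≤ 1) (x : ι → K) :
    listAvg l u x ≤ 1 := by
  induction l generalizing x with
  | nil => exact hu x
  | cons j l ih => exact expect_le univ_nonempty fun i _ => ih _

variable [Fintype ι]

theorem expect_lineAvg (j : ι) (u : (ι → K) → ℝ) : 𝔼 x, lineAvg j u x = 𝔼 x, u x := by
  unfold lineAvg
  rw [expect_comm]
  calc _ = 𝔼 _h : K, 𝔼 x, u x := expect_congr rfl fun i _ => expect_add_right u _
    _ = _ := expect_const univ_nonempty _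

theorem expect_mul_eq_expect_lineAvg_mul (j : ι) (u v : (ι → K) → ℝ)
    (hv : ∀ x h, v (x + Pi.single j h) = v x) :
    𝔼 x, u x * v x = 𝔼 x, lineAvg j u x * v x := by
  rw [← expect_lineAvg j]
  exact expect_congr rfl fun x _ => lineAvg_mul j u v hv x

theorem expect_sub_lineAvg_sq (j : ι) (u : (ι → K) → ℝ) :
    𝔼 x, (u x - lineAvg j u x) ^ 2 = 𝔼 x, u x ^ 2 - 𝔼 x, lineAvg j u x ^ 2 := by
  have h := expect_mul_eq_expect_lineAvg_mul j u (lineAvg j u)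
    fun x h => lineAvg_add_single j u h x
  calc _ = 𝔼 x, (u x ^ 2 - 2 * (u x * lineAvg j u x) + lineAvg j u x * lineAvg j u x) :=
        expect_congr rfl fun x _ => by ring
    _ = _ := by
        rw [expect_add_distrib, expect_sub_distrib, ← mul_expect, h]
        simp only [sq]; ring

theorem shiftEnergy_sub_lineAvg (h : ι → K) (j : ι) (u : (ι → K) → ℝ) :
    shiftEnergy h (fun x => u x - lineAvg j u x) =
      shiftEnergy h u - shiftEnergy h (lineAvg j u) := by
  have := expect_sub_lineAvg_sq j (fun x => u x - u (x + h))
  simp only [lineAvg_sub, lineAvg_comp_add] at this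
  unfold shiftEnergy
  rw [← this]
  exact expect_congr rfl fun x _ => by ring

theorem shiftEnergy_sqrt_lineAvg_le (h : ι → K) (j : ι) (g : (ι → K) → ℝ) :
    shiftEnergy h (fun x => √(lineAvg j (fun x => g x ^ 2) x)) ≤ shiftEnergy h g :=
  shiftEnergy_sqrt_expect_le univ univ_nonempty (fun i : K => (Pi.single j i : ι → K)) h g

theorem expect_abs_lineAvg_le (j : ι) (u : (ι → K) → ℝ) :
    𝔼 x, |lineAvg j u x| ≤ 𝔼 x, |u x| := by
  rw [← expect_lineAvg j (fun x => |u x|)]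
  exact expect_le_expect fun x _ => abs_expect_le _ _

theorem expect_abs_sub_lineAvg_le (j : ι) (u : (ι → K) → ℝ) :
    𝔼 x, |u x - lineAvg j u x| ≤ 𝔼 h : K, 𝔼 x, |u x - u (x + Pi.single j h)| := by
  rw [expect_comm]
  refine expect_le_expect fun x _ => ?_
  refine le_trans (le_of_eq ?_) (abs_expect_le _ _)
  rw [expect_sub_distrib, expect_const univ_nonempty, lineAvg]

theorem expect_listAvg (l : List ι) (u : (ι → K) → ℝ) : 𝔼 x, listAvg l u x = 𝔼 x, u x := by
  induction l with
  | nil => rfl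
  | cons j l ih => rw [listAvg_cons, expect_lineAvg, ih]

theorem expect_mul_eq_expect_listAvg_mul (l : List ι) (u v : (ι → K) → ℝ)
    (hv : ∀ j ∈ l, ∀ x h, v (x + Pi.single j h) = v x) :
    𝔼 x, u x * v x = 𝔼 x, listAvg l u x * v x := by
  induction l with
  | nil => rfl
  | cons j l ih =>
    rw [ih fun i hi => hv i (List.mem_cons_of_mem _ hi), listAvg_cons,
      expect_mul_eq_expect_lineAvg_mul j _ v (hv j List.mem_cons_self)]

theorem listAvg_univ (u : (ι → K) → ℝ) (x : ι → K) :
    listAvg (univ : Finset ι).toList u x = 𝔼 y, u y := by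
  have h : ∀ y, listAvg (univ : Finset ι).toList u y = listAvg (univ : Finset ι).toList u x := by
    intro y
    refine dependsOn_of_forall_add_single (listAvg (univ : Finset ι).toList u) ∅
      (fun j _ x h => listAvg_add_single (by simp) u h x) ?_
    simp
  rw [← expect_listAvg (univ : Finset ι).toList u]
  simp only [h]
  exact (expect_const univ_nonempty _).symm

end LineAverages

/-! ### A logarithmic Sobolev inequality on the discrete torus -/

section LogSobolev

variable {ι : Type*} [DecidableEq ι] {k : ℕ}

/-- The average of `u` over the first `m` points of the line through `x` in direction `j`. -/
noncomputable def blockAvg (j : ι) (m : ℕ) (u : (ι → ZMod k) → ℝ) (x : ι → ZMod k) : ℝ :=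
  𝔼 i ∈ range m, u (x + Pi.single j (i : ZMod k))

theorem blockAvg_two_mul (j : ι) {m : ℕ} (hm : m ≠ 0) (u : (ι → ZMod k) → ℝ) (x : ι → ZMod k) :
    blockAvg j (2 * m) u x =
      (blockAvg j m u x + blockAvg j m u (x + Pi.single j (m : ZMod k))) / 2 := by
  have hm' : (m : ℝ) ≠ 0 := by exact_mod_cast hm
  simp only [blockAvg, expect_eq_sum_div_card, card_range]
  rw [two_mul, sum_range_add]
  have : ∀ i : ℕ, x + Pi.single j ((m + i : ℕ) : ZMod k) =
      x + Pi.single j (m : ZMod k) + Pi.single j (i : ZMod k) := fun i => by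
    rw [add_assoc, ← Pi.single_add, Nat.cast_add]
  simp only [this]
  push_cast
  field_simp
  ring

variable [NeZero k]

theorem lineAvg_blockAvg (j : ι) {m : ℕ} (hm : m ≠ 0) (u : (ι → ZMod k) → ℝ) (x : ι → ZMod k) :
    lineAvg j (blockAvg j m u) x = lineAvg j u x := by
  calc _ = 𝔼 i ∈ range m, 𝔼 h : ZMod k, u (x + Pi.single j h + Pi.single j (i : ZMod k)) :=
        expect_comm _ _ _
    _ = 𝔼 i ∈ range m, lineAvg j u x := by
        refine expect_congr rfl fun i _ => ?_
        refine Eq.trans ?_ (expect_add_right (fun h : ZMod k => u (x + Pi.single j h)) (i : ZMod k))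
        exact expect_congr rfl fun h _ => by rw [add_assoc, ← Pi.single_add]
    _ = _ := expect_const (by simpa using hm) _

theorem blockAvg_le_lineAvg (j : ι) {m : ℕ} (hm : m ≤ k) (hm2 : k ≤ 2 * m)
    {u : (ι → ZMod k) → ℝ} (hu : ∀ x, 0 ≤ u x) (x : ι → ZMod k) :
    blockAvg j m u x ≤ 2 * lineAvg j u x := by
  have hk : (0 : ℝ) < k := by exact_mod_cast NeZero.pos k
  have hm0 : (0 : ℝ) < m := by
    have := NeZero.pos k
    exact_mod_cast (by omega : 0 < m)
  have h1 : ∑ i ∈ range m, u (x + Pi.single j (i : ZMod k)) ≤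
      ∑ h : ZMod k, u (x + Pi.single j h) := by
    refine le_of_eq_of_le (sum_image (s := range m) (g := fun i : ℕ => (i : ZMod k))
      (f := fun h : ZMod k => u (x + Pi.single j h)) ?_).symm ?_
    rotate_left
    · exact sum_le_sum_of_subset_of_nonneg (subset_univ _) fun _ _ _ => hu _
    · intro a ha b hb hab
      have ha' : a < k := (mem_range.1 ha).trans_le hm
      have hb' : b < k := (mem_range.1 hb).trans_le hm
      have := congrArg ZMod.val hab
      simpa [ZMod.val_natCast, Nat.mod_eq_of_lt ha', Nat.mod_eq_of_lt hb'] using this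
  have h2 : 0 ≤ ∑ h : ZMod k, u (x + Pi.single j h) := sum_nonneg fun _ _ => hu _
  simp only [blockAvg, lineAvg, expect_eq_sum_div_card, card_range, card_univ, ZMod.card]
  have hm2' : (k : ℝ) ≤ 2 * m := by exact_mod_cast hm2
  rw [div_le_iff₀ hm0]
  refine h1.trans ?_
  calc _ = (∑ h : ZMod k, u (x + Pi.single j h)) / k * k := by field_simp
    _ ≤ (∑ h : ZMod k, u (x + Pi.single j h)) / k * (2 * m) := by gcongr
    _ = _ := by ring

variable [Fintype ι]

theorem expect_mul_log_le_blockAvg (j : ι) (g : (ι → ZMod k) → ℝ) (r : ℕ) :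
    𝔼 x, g x ^ 2 * Real.log (g x ^ 2) ≤
      (𝔼 x, blockAvg j (2 ^ r) (fun x => g x ^ 2) x *
        Real.log (blockAvg j (2 ^ r) (fun x => g x ^ 2) x)) +
      ∑ s ∈ range r, shiftEnergy (Pi.single j ((2 ^ s : ℕ) : ZMod k)) g := by
  induction r with
  | zero =>
    simp [blockAvg]
  | succ r ih =>
    refine ih.trans ?_
    have h1 := expect_mul_log_le_pair (blockAvg j (2 ^ r) (fun x => g x ^ 2))
      (fun x => expect_nonneg fun i _ => sq_nonneg _) (Pi.single j ((2 ^ r : ℕ) : ZMod k))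
    simp only [← blockAvg_two_mul j (pow_ne_zero r two_ne_zero)] at h1
    have h2 : shiftEnergy (Pi.single j ((2 ^ r : ℕ) : ZMod k))
        (fun x => √(blockAvg j (2 ^ r) (fun x => g x ^ 2) x)) ≤
        shiftEnergy (Pi.single j ((2 ^ r : ℕ) : ZMod k)) g :=
      shiftEnergy_sqrt_expect_le (range (2 ^ r)) (by simp)
        (fun i : ℕ => (Pi.single j (i : ZMod k) : ι → ZMod k)) _ g
    rw [sum_range_succ, pow_succ']
    linarith

/-- The energy of `g` in direction `j`: a nonnegative combination of mean square increments
which, for the indicator function of an interval, is comparable to that of a unit step. -/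
noncomputable def lineEnergy (j : ι) (g : (ι → ZMod k) → ℝ) : ℝ :=
  ∑ s ∈ range (Nat.log 2 k), shiftEnergy (Pi.single j ((2 ^ s : ℕ) : ZMod k)) g +
    6 * 𝔼 h : ZMod k, shiftEnergy (Pi.single j h) g

theorem lineEnergy_nonneg (j : ι) (g : (ι → ZMod k) → ℝ) : 0 ≤ lineEnergy j g :=
  add_nonneg (sum_nonneg fun _ _ => shiftEnergy_nonneg _ _)
    (mul_nonneg (by norm_num) (expect_nonneg fun _ _ => shiftEnergy_nonneg _ _))

theorem lineEnergy_mono (j : ι) {g g' : (ι → ZMod k) → ℝ}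
    (h : ∀ v, shiftEnergy v g ≤ shiftEnergy v g') : lineEnergy j g ≤ lineEnergy j g' :=
  add_le_add (sum_le_sum fun _ _ => h _)
    (mul_le_mul_of_nonneg_left (expect_le_expect fun _ _ => h _) (by norm_num))

theorem lineEnergy_sub_lineAvg (i j : ι) (u : (ι → ZMod k) → ℝ) :
    lineEnergy i (fun x => u x - lineAvg j u x) = lineEnergy i u - lineEnergy i (lineAvg j u) := by
  simp only [lineEnergy, shiftEnergy_sub_lineAvg, sum_sub_distrib, expect_sub_distrib]
  ring

theorem expect_mul_log_le_lineAvg (j : ι) (g : (ι → ZMod k) → ℝ) :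
    𝔼 x, g x ^ 2 * Real.log (g x ^ 2) ≤
      (𝔼 x, lineAvg j (fun x => g x ^ 2) x * Real.log (lineAvg j (fun x => g x ^ 2) x)) +
      lineEnergy j g := by
  set m := 2 ^ Nat.log 2 k with hm
  set Y := lineAvg j (fun x => g x ^ 2) with hY
  set X := blockAvg j m (fun x => g x ^ 2) with hX
  have hmk : m ≤ k := Nat.pow_log_le_self 2 (NeZero.ne k)
  have hkm : k ≤ 2 * m := by
    rw [hm, ← pow_succ']; exact (Nat.lt_pow_succ_log_self one_lt_two k).le
  have hm0 : m ≠ 0 := by positivity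
  have h1 := expect_mul_log_le_blockAvg j g (Nat.log 2 k)
  have hX0 : ∀ x, 0 ≤ X x := fun x => expect_nonneg fun i _ => sq_nonneg _
  have hXY : lineAvg j X = Y := funext fun x => lineAvg_blockAvg j hm0 _ x
  have hle : ∀ x, X x ≤ 2 * Y x := fun x => blockAvg_le_lineAvg j hmk hkm (fun _ => sq_nonneg _) x
  have hlog : 𝔼 x, X x * Real.log (Y x) = 𝔼 x, Y x * Real.log (Y x) := by
    rw [expect_mul_eq_expect_lineAvg_mul j X (fun x => Real.log (Y x)), hXY]
    intro x h
    simp only [hY, lineAvg_add_single]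
  have hE : 𝔼 x, X x = 𝔼 x, Y x := by rw [← hXY, expect_lineAvg]
  have h2 : 𝔼 x, X x * Real.log (X x) ≤
      (𝔼 x, Y x * Real.log (Y x)) + 6 * 𝔼 x, (√(X x) - √(Y x)) ^ 2 := by
    calc _ ≤ 𝔼 x, (X x * Real.log (Y x) + (X x - Y x) + 6 * (√(X x) - √(Y x)) ^ 2) :=
          expect_le_expect fun x _ => mul_log_le_of_le_two_mul (hX0 x) (hle x)
      _ = _ := by
          rw [expect_add_distrib, expect_add_distrib, expect_sub_distrib, hlog, hE, ← mul_expect]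
          ring
  have h3 : 𝔼 x, (√(X x) - √(Y x)) ^ 2 ≤
      𝔼 h : ZMod k, shiftEnergy (Pi.single j h) (fun x => √(X x)) := by
    unfold shiftEnergy
    rw [expect_comm]
    refine expect_le_expect fun x _ => ?_
    have := sq_sqrt_expect_sub_le (univ : Finset (ZMod k)) (fun _ => √(X x))
      (fun h => √(X (x + Pi.single j h)))
    simp only [Real.sq_sqrt (hX0 _)] at this
    rw [expect_const univ_nonempty] at this
    rwa [← hXY]
  have h4 : 𝔼 h : ZMod k, shiftEnergy (Pi.single j h) (fun x => √(X x)) ≤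
      𝔼 h : ZMod k, shiftEnergy (Pi.single j h) g :=
    expect_le_expect fun h _ => shiftEnergy_sqrt_expect_le (range m) (by simpa using hm0)
      (fun i : ℕ => (Pi.single j (i : ZMod k) : ι → ZMod k)) _ g
  unfold lineEnergy
  linarith

theorem shiftEnergy_sqrt_listAvg_le (h : ι → ZMod k) (l : List ι) (g : (ι → ZMod k) → ℝ) :
    shiftEnergy h (fun x => √(listAvg l (fun x => g x ^ 2) x)) ≤ shiftEnergy h g := by
  induction l with
  | nil =>
    simp only [listAvg, List.foldr_nil, Real.sqrt_sq_eq_abs]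
    exact expect_le_expect fun x _ => sq_le_sq.2 (abs_abs_sub_abs_le_abs_sub _ _)
  | cons j l ih =>
    refine le_trans (le_of_eq ?_) ((shiftEnergy_sqrt_lineAvg_le h j _).trans ih)
    simp only [Real.sq_sqrt (listAvg_nonneg l (fun _ => sq_nonneg _) _)]
    rfl

theorem expect_mul_log_le_listAvg (l : List ι) (g : (ι → ZMod k) → ℝ) :
    𝔼 x, g x ^ 2 * Real.log (g x ^ 2) ≤
      (𝔼 x, listAvg l (fun x => g x ^ 2) x * Real.log (listAvg l (fun x => g x ^ 2) x)) +
      (l.map fun j => lineEnergy j g).sum := by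
  induction l with
  | nil => simp [listAvg]
  | cons j l ih =>
    have h := expect_mul_log_le_lineAvg j (fun x => √(listAvg l (fun x => g x ^ 2) x))
    simp only [Real.sq_sqrt (listAvg_nonneg l (fun _ => sq_nonneg (g _)) _)] at h
    have h2 := lineEnergy_mono j fun v => shiftEnergy_sqrt_listAvg_le v l g
    rw [List.map_cons, List.sum_cons]
    simp only [listAvg_cons]
    linarith

/-- The logarithmic Sobolev inequality. -/
theorem entropy_sq_le_sum_lineEnergy (g : (ι → ZMod k) → ℝ) :
    (𝔼 x, g x ^ 2 * Real.log (g x ^ 2)) - (𝔼 x, g x ^ 2) * Real.log (𝔼 x, g x ^ 2) ≤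
      ∑ j, lineEnergy j g := by
  have h := expect_mul_log_le_listAvg (univ : Finset ι).toList g
  simp only [listAvg_univ, expect_const univ_nonempty, sum_map_toList] at h
  linarith

/-! ### Martingale differences -/

theorem expect_abs_listAvg_sub_le (l : List ι) (f : (ι → ZMod k) → ℝ) (h : ι → ZMod k) :
    𝔼 x, |listAvg l f x - listAvg l f (x + h)| ≤ 𝔼 x, |f x - f (x + h)| := by
  induction l with
  | nil => rfl
  | cons j l ih =>
    refine le_trans (le_of_eq ?_) ((expect_abs_lineAvg_le j _).trans ih)
    simp only [lineAvg_sub, lineAvg_comp_add, listAvg_cons]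

/-- The mean oscillation of `f` along lines in direction `j`. -/
noncomputable def lineVariation (j : ι) (f : (ι → ZMod k) → ℝ) : ℝ :=
  𝔼 h : ZMod k, 𝔼 x, |f x - f (x + Pi.single j h)|

theorem variance_listAvg_mul_log_le_aux (f : (ι → ZMod k) → ℝ) {L : ℝ} (hL : 0 < L) (l : List ι) :
    ((𝔼 x, f x ^ 2) - 𝔼 x, listAvg l f x ^ 2) * (1 + Real.log L) -
        L * (l.map fun j => lineVariation j f ^ 2).sum ≤
      ∑ i, lineEnergy i f - ∑ i, lineEnergy i (listAvg l f) := by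
  induction l with
  | nil => simp [listAvg]
  | cons j l ih =>
    have ha : 𝔼 x, |listAvg l f x - lineAvg j (listAvg l f) x| ≤ lineVariation j f :=
      (expect_abs_sub_lineAvg_le j _).trans
        (expect_le_expect fun h _ => expect_abs_listAvg_sub_le l f _)
    have h1 := le_entropy_sq _ ha hL
    have h2 := entropy_sq_le_sum_lineEnergy fun x => listAvg l f x - lineAvg j (listAvg l f) x
    simp only [lineEnergy_sub_lineAvg, sum_sub_distrib] at h2
    rw [expect_sub_lineAvg_sq] at h1 h2
    rw [List.map_cons, List.sum_cons]
    simp only [listAvg_cons]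
    linarith

/-- The Falik–Samorodnitsky inequality: a bound for the variance of `f` along a set of
coordinates in terms of energies and variations. -/
theorem variance_listAvg_mul_log_le (f : (ι → ZMod k) → ℝ) {L : ℝ} (hL : 0 < L) (l : List ι) :
    ((𝔼 x, f x ^ 2) - 𝔼 x, listAvg l f x ^ 2) * (1 + Real.log L) ≤
      ∑ i, lineEnergy i f + L * (l.map fun j => lineVariation j f ^ 2).sum := by
  have h := variance_listAvg_mul_log_le_aux f hL l
  have h0 : 0 ≤ ∑ i, lineEnergy i (listAvg l f) := sum_nonneg fun i _ => lineEnergy_nonneg i _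
  linarith

end LogSobolev

/-! ### The junta theorem on the discrete torus -/

section TorusJunta

variable {ι : Type*} [DecidableEq ι] [Fintype ι] {k : ℕ}

/-- The mean increment of `f` in direction `j`. -/
noncomputable def stepVariation [NeZero k] (j : ι) (f : (ι → ZMod k) → ℝ) : ℝ :=
  𝔼 x, |f x - f (x + Pi.single j 1)|

variable [NeZero k]

theorem stepVariation_nonneg (j : ι) (f : (ι → ZMod k) → ℝ) : 0 ≤ stepVariation j f :=
  expect_nonneg fun _ _ => abs_nonneg _

theorem expect_abs_sub_add_natCast_le (j : ι) (f : (ι → ZMod k) → ℝ) (m : ℕ) :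
    𝔼 x, |f x - f (x + Pi.single j (m : ZMod k))| ≤ m * stepVariation j f := by
  induction m with
  | zero => simp
  | succ m ih =>
    have h1 : 𝔼 x, |f x - f (x + Pi.single j ((m + 1 : ℕ) : ZMod k))| ≤
        𝔼 x, (|f x - f (x + Pi.single j (m : ZMod k))| +
          |f (x + Pi.single j (m : ZMod k)) -
            f (x + Pi.single j (m : ZMod k) + Pi.single j 1)|) := by
      refine expect_le_expect fun x _ => ?_
      rw [add_assoc, ← Pi.single_add, ← Nat.cast_succ]
      exact abs_sub_le _ _ _
    have h2 := expect_add_right (fun x : ι → ZMod k => |f x - f (x + Pi.single j 1)|)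
      (Pi.single j (m : ZMod k))
    rw [expect_add_distrib] at h1
    refine h1.trans ((add_le_add ih h2.le).trans (le_of_eq ?_))
    rw [Nat.cast_succ, add_one_mul, stepVariation]

theorem lineVariation_le (j : ι) (f : (ι → ZMod k) → ℝ) :
    lineVariation j f ≤ k * stepVariation j f := by
  refine expect_le univ_nonempty fun h _ => ?_
  have := expect_abs_sub_add_natCast_le j f h.val
  rw [ZMod.natCast_zmod_val] at this
  refine this.trans (mul_le_mul_of_nonneg_right ?_ (stepVariation_nonneg j f))
  exact_mod_cast (ZMod.val_lt h).le

theorem shiftEnergy_eq_of_zero_one {f : (ι → ZMod k) → ℝ} (hf : ∀ x, f x = 0 ∨ f x = 1)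
    (h : ι → ZMod k) : shiftEnergy h f = 𝔼 x, |f x - f (x + h)| := by
  refine expect_congr rfl fun x _ => ?_
  rcases hf x with h1 | h1 <;> rcases hf (x + h) with h2 | h2 <;> simp [h1, h2]

theorem lineEnergy_le (j : ι) {f : (ι → ZMod k) → ℝ} (hf : ∀ x, f x = 0 ∨ f x = 1) :
    lineEnergy j f ≤ 7 * (k * stepVariation j f) := by
  have h1 : ∑ s ∈ range (Nat.log 2 k), shiftEnergy (Pi.single j ((2 ^ s : ℕ) : ZMod k)) f ≤
      k * stepVariation j f := by
    calc _ ≤ ∑ s ∈ range (Nat.log 2 k), ((2 ^ s : ℕ) : ℝ) * stepVariation j f :=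
          sum_le_sum fun s _ => by
            rw [shiftEnergy_eq_of_zero_one hf]
            exact expect_abs_sub_add_natCast_le j f (2 ^ s)
      _ = ((∑ s ∈ range (Nat.log 2 k), 2 ^ s : ℕ) : ℝ) * stepVariation j f := by
          rw [← sum_mul]; push_cast; rfl
      _ ≤ _ := by
          refine mul_le_mul_of_nonneg_right ?_ (stepVariation_nonneg j f)
          have h2 : ∑ s ∈ range (Nat.log 2 k), 2 ^ s ≤ k := by
            rw [Nat.geomSum_eq le_rfl]
            have := Nat.pow_log_le_self 2 (NeZero.ne k)
            simp
            omega
          exact_mod_cast h2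
  have h3 : 𝔼 h : ZMod k, shiftEnergy (Pi.single j h) f ≤ k * stepVariation j f := by
    simp only [shiftEnergy_eq_of_zero_one hf]
    exact lineVariation_le j f
  unfold lineEnergy
  linarith

theorem exists_round_listAvg {f : (ι → ZMod k) → ℝ} (hf : ∀ x, f x = 0 ∨ f x = 1) (J : Finset ι) :
    ∃ g : (ι → ZMod k) → ℝ, (∀ x, g x = 0 ∨ g x = 1) ∧ DependsOn g (J : Set ι) ∧
      𝔼 x, |f x - g x| ≤ 2 * ((𝔼 x, f x ^ 2) - 𝔼 x, listAvg (univ \ J).toList f x ^ 2) := by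
  set l := (univ \ J).toList with hl
  set p := listAvg l f with hp
  have hp0 : ∀ x, 0 ≤ p x := listAvg_nonneg l fun x => by rcases hf x with h | h <;> simp [h]
  have hp1 : ∀ x, p x ≤ 1 := listAvg_le_one l fun x => by rcases hf x with h | h <;> simp [h]
  have hpinv : ∀ j ∈ l, ∀ x h, p (x + Pi.single j h) = p x :=
    fun j hj x h => listAvg_add_single hj f h x
  set g : (ι → ZMod k) → ℝ := fun x => if 1 / 2 ≤ p x then 1 else 0 with hg
  have hginv : ∀ j ∈ l, ∀ x h, g (x + Pi.single j h) = g x :=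
    fun j hj x h => by simp only [hg, hpinv j hj]
  have hg01 : ∀ x, g x = 0 ∨ g x = 1 := fun x => by simp only [hg]; split_ifs <;> simp
  refine ⟨g, hg01, dependsOn_of_forall_add_single g J fun j hj => hginv j (by simp [hl, hj]), ?_⟩
  have hfg := expect_mul_eq_expect_listAvg_mul l f g hginv
  have hfp : 𝔼 x, f x ^ 2 = 𝔼 x, p x := by
    rw [hp, expect_listAvg]
    exact expect_congr rfl fun x _ => by rcases hf x with h | h <;> simp [h]
  have hfp' : 𝔼 x, f x = 𝔼 x, p x := (expect_listAvg l f).symm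
  calc 𝔼 x, |f x - g x| = 𝔼 x, (f x + g x - 2 * (f x * g x)) := by
        refine expect_congr rfl fun x _ => ?_
        rcases hf x with h1 | h1 <;> rcases hg01 x with h2 | h2 <;> norm_num [h1, h2]
    _ = 𝔼 x, (p x + g x - 2 * (p x * g x)) := by
        simp only [expect_sub_distrib, expect_add_distrib, ← mul_expect, hfg, hfp', hp]
    _ ≤ 𝔼 x, 2 * (p x - p x ^ 2) := by
        refine expect_le_expect fun x _ => ?_
        simp only [hg]
        split_ifs with h
        · nlinarith [hp1 x]
        · nlinarith [hp0 x]
    _ = _ := by rw [← mul_expect, expect_sub_distrib, hfp]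

/-- A junta theorem on the discrete torus, in terms of the total variation along coordinate
directions. -/
theorem exists_torus_junta {f : (ι → ZMod k) → ℝ} (hf : ∀ x, f x = 0 ∨ f x = 1) {a ε : ℝ}
    (ha : ∑ j, k * stepVariation j f ≤ a) (hε : 0 < ε) (hε1 : ε ≤ 1) :
    ∃ (J : Finset ι) (g : (ι → ZMod k) → ℝ), (∀ x, g x = 0 ∨ g x = 1) ∧
      DependsOn g (J : Set ι) ∧ 𝔼 x, |f x - g x| ≤ ε ∧ (J.card : ℝ) ≤ Real.exp (18 * a / ε) := by
  classical
  set b : ι → ℝ := fun j => k * stepVariation j f with hb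
  have hb0 : ∀ j, 0 ≤ b j := fun j => mul_nonneg (Nat.cast_nonneg _) (stepVariation_nonneg j f)
  have ha0 : 0 ≤ a := (sum_nonneg fun j _ => hb0 j).trans ha
  set δ := ε / 2 with hδ
  have hδ0 : 0 < δ := by positivity
  set L := Real.exp (7 * (a / δ)) with hL
  have hL0 : 0 < L := Real.exp_pos _
  set J : Finset ι := {j | δ < b j * (L * a)} with hJ
  obtain ⟨g, hg, hgJ, hfg⟩ := exists_round_listAvg hf J
  refine ⟨J, g, hg, hgJ, ?_, ?_⟩
  · have h1 := variance_listAvg_mul_log_le f hL0 (univ \ J).toList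
    set V := (𝔼 x, f x ^ 2) - 𝔼 x, listAvg (univ \ J).toList f x ^ 2
    have h2 : ∑ i, lineEnergy i f ≤ 7 * a := by
      calc _ ≤ ∑ i, 7 * b i := sum_le_sum fun i _ => lineEnergy_le i hf
        _ = 7 * ∑ i, b i := by rw [mul_sum]
        _ ≤ _ := by linarith
    have h3 : ∑ j ∈ univ \ J, lineVariation j f ^ 2 ≤ ∑ j ∈ univ \ J, b j ^ 2 :=
      sum_le_sum fun j _ => pow_le_pow_left₀
        (expect_nonneg fun _ _ => expect_nonneg fun _ _ => abs_nonneg _) (lineVariation_le j f) 2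
    have h4 : ∑ j ∈ univ \ J, b j ≤ a := (sum_le_sum_of_subset_of_nonneg (subset_univ _)
      fun j _ _ => hb0 j).trans ha
    have h5 : L * ∑ j ∈ univ \ J, b j ^ 2 ≤ δ := by
      rcases ha0.eq_or_lt with h0 | hpos
      · have : ∀ j, b j = 0 := fun j =>
          le_antisymm ((single_le_sum (fun i _ => hb0 i) (mem_univ j)).trans (h0 ▸ ha)) (hb0 j)
        simp [this, hδ0.le]
      · have : (L * ∑ j ∈ univ \ J, b j ^ 2) * a ≤ δ * a := by
          calc _ = ∑ j ∈ univ \ J, (b j * (L * a)) * b j := by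
                rw [mul_sum, sum_mul]; exact sum_congr rfl fun j _ => by ring
            _ ≤ ∑ j ∈ univ \ J, δ * b j := sum_le_sum fun j hj => by
                refine mul_le_mul_of_nonneg_right ?_ (hb0 j)
                simpa [hJ] using hj
            _ ≤ δ * a := by rw [← mul_sum]; gcongr
        exact le_of_mul_le_mul_right this hpos
    rw [hL, Real.log_exp, sum_map_toList, ← hL] at h1
    have h6 : V * (1 + 7 * (a / δ)) ≤ δ * (1 + 7 * (a / δ)) := by
      have e : δ * (1 + 7 * (a / δ)) = δ + 7 * a := by field_simp
      have := mul_le_mul_of_nonneg_left h3 hL0.le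
      linarith
    have h7 : V ≤ δ := le_of_mul_le_mul_right h6 (by positivity)
    linarith
  · have h1 : J.card * δ ≤ L * a ^ 2 := by
      calc J.card * δ = ∑ _j ∈ J, δ := by simp
        _ ≤ ∑ j ∈ J, b j * (L * a) := sum_le_sum fun j hj => (by simpa [hJ] using hj : _ < _).le
        _ ≤ ∑ j, b j * (L * a) := sum_le_sum_of_subset_of_nonneg (subset_univ _)
            fun j _ _ => mul_nonneg (hb0 j) (by positivity)
        _ = (∑ j, b j) * (L * a) := by rw [sum_mul]
        _ ≤ a * (L * a) := by gcongr
        _ = _ := by ring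
    have hy : a / δ ≤ Real.exp (a / δ) := by
      have := Real.add_one_le_exp (a / δ); linarith
    have hy0 : 0 ≤ a / δ := by positivity
    have h2 : (J.card : ℝ) ≤ L * (a / δ) ^ 2 := by
      have e : L * (a / δ) ^ 2 * δ = L * a ^ 2 / δ := by field_simp
      have : L * a ^ 2 ≤ L * a ^ 2 / δ := by
        rw [le_div_iff₀ hδ0]
        exact mul_le_of_le_one_right (by positivity) (by linarith)
      exact le_of_mul_le_mul_right (by linarith) hδ0
    calc _ ≤ L * (a / δ) ^ 2 := h2
      _ ≤ L * Real.exp (a / δ) ^ 2 := by gcongr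
      _ = _ := by
        rw [← Real.exp_nat_mul, hL, ← Real.exp_add]
        congr 1
        rw [hδ]; push_cast; field_simp; ring

end TorusJunta

/-! ### The boundary in the grid and in the torus -/

/-- The identification of `Fin k` with `ℤ/kℤ` which preserves representatives. -/
def finEquivZMod (k : ℕ) [NeZero k] : Fin k ≃ ZMod k where
  toFun a := ((a : ℕ) : ZMod k)
  invFun a := ⟨a.val, ZMod.val_lt a⟩
  left_inv a := Fin.ext (by simp [ZMod.val_natCast, Nat.mod_eq_of_lt a.2])
  right_inv a := by simp

/-- The identification of the grid with the torus. -/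
def gridEquivTorus (k n : ℕ) [NeZero k] : (Fin n → Fin k) ≃ (Fin n → ZMod k) :=
  Equiv.piCongrRight fun _ => finEquivZMod k

section Boundary

theorem val_add_one {k : ℕ} {a : ZMod k} (h : a.val + 1 < k) : (a + 1).val = a.val + 1 := by
  have : Fact (1 < k) := ⟨by omega⟩
  rw [ZMod.val_add_of_lt] <;> rw [ZMod.val_one]
  exact h

variable {k n : ℕ} [NeZero k]

theorem gridEquivTorus_apply (x : Fin n → Fin k) (i : Fin n) :
    gridEquivTorus k n x i = ((x i : ℕ) : ZMod k) := rfl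

theorem gridEquivTorus_symm_apply (x : Fin n → ZMod k) (i : Fin n) :
    (((gridEquivTorus k n).symm x i : Fin k) : ℕ) = (x i).val := rfl

open Classical in
/-- The pairs of a direction and a point such that the step from the point in that direction
enters or leaves the set `p`. -/
noncomputable def torusBoundary (p : Set (Fin n → ZMod k)) : Finset (Fin n × (Fin n → ZMod k)) :=
  {q | ¬ (q.2 ∈ p ↔ q.2 + Pi.single q.1 1 ∈ p)}

theorem mem_torusBoundary {p : Set (Fin n → ZMod k)} {q : Fin n × (Fin n → ZMod k)} :
    q ∈ torusBoundary p ↔ ¬ (q.2 ∈ p ↔ q.2 + Pi.single q.1 1 ∈ p) := by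
  simp [torusBoundary]

theorem gridBoundary_ncard_le (A : Set (Fin n → Fin k)) :
    (gridBoundary A).ncard ≤ (torusBoundary ((gridEquivTorus k n).symm ⁻¹' A)).card := by
  classical
  set φ := gridEquivTorus k n with hφ
  have key : ∀ x y : Fin n → Fin k, ∀ j, ((y j : ℕ) : ℤ) = (x j : ℕ) + 1 →
      (∀ i, i ≠ j → x i = y i) → φ x + Pi.single j 1 = φ y := by
    intro x y j hj h
    funext i
    rcases eq_or_ne i j with rfl | hi
    · rw [Pi.add_apply, Pi.single_eq_same, hφ, gridEquivTorus_apply, gridEquivTorus_apply]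
      rw [show ((y i : ℕ)) = (x i : ℕ) + 1 by exact_mod_cast hj]
      push_cast; rfl
    · rw [Pi.add_apply, Pi.single_eq_of_ne hi, add_zero, hφ, gridEquivTorus_apply,
        gridEquivTorus_apply, h i hi]
  have hsub : gridBoundary A ⊆ (((torusBoundary (φ.symm ⁻¹' A)).image
      fun q => s(φ.symm q.2, φ.symm (q.2 + Pi.single q.1 1)) : Finset _) : Set _) := by
    rintro e ⟨x, hx, y, hy, ⟨j, hj, h⟩, rfl⟩
    rw [mem_coe, mem_image]
    rcases (abs_eq (by norm_num : (0 : ℤ) ≤ 1)).1 hj with h1 | h1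
    · have e := key y x j (by linarith) fun i hi => (h i hi).symm
      exact ⟨(j, φ y), mem_torusBoundary.2 (by simp [e, hx, hy]), by simp [e, Sym2.eq_swap]⟩
    · have e := key x y j (by linarith) h
      exact ⟨(j, φ x), mem_torusBoundary.2 (by simp [e, hx, hy]), by simp [e]⟩
  refine (Set.ncard_le_ncard hsub (finite_toSet _)).trans ?_
  rw [Set.ncard_coe_finset]
  exact card_image_le

/-- A wrapping boundary step is compensated by a boundary step on the same line which does
not wrap. -/
theorem exists_boundary_step (p : Set (Fin n → ZMod k)) (j : Fin n) {x : Fin n → ZMod k}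
    (hx : (x j).val + 1 = k) (h : ¬ (x ∈ p ↔ x + Pi.single j 1 ∈ p)) :
    ∃ c : ZMod k, ((x + Pi.single j c : Fin n → ZMod k) j).val + 1 < k ∧
      ¬ (x + Pi.single j c ∈ p ↔ x + Pi.single j c + Pi.single j 1 ∈ p) := by
  by_contra! hcon
  have key : ∀ i : ℕ, i < k →
      (x + Pi.single j ((i + 1 : ℕ) : ZMod k) ∈ p ↔ x + Pi.single j 1 ∈ p) := by
    intro i
    induction i with
    | zero => simp
    | succ i ih =>
      intro hi
      rw [← ih (by omega)]
      have hv : ((x + Pi.single j ((i + 1 : ℕ) : ZMod k) : Fin n → ZMod k) j).val = i := by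
        have : (x j : ZMod k) = ((k - 1 : ℕ) : ZMod k) := by
          rw [← ZMod.natCast_zmod_val (x j)]; congr 1; omega
        rw [Pi.add_apply, Pi.single_eq_same, this, ← Nat.cast_add,
          show k - 1 + (i + 1) = i + k by omega, Nat.cast_add, ZMod.natCast_self, add_zero,
          ZMod.val_natCast, Nat.mod_eq_of_lt (by omega)]
      have := hcon ((i + 1 : ℕ) : ZMod k) (by rw [hv]; omega)
      rw [this, add_assoc x, ← Pi.single_add, ← Nat.cast_succ]
  have hk := NeZero.pos k
  have h2 := key (k - 1) (by omega)
  rw [Nat.sub_add_cancel hk, ZMod.natCast_self, Pi.single_zero, add_zero] at h2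
  exact h h2

theorem torusBoundary_card_le (A : Set (Fin n → Fin k)) :
    (torusBoundary ((gridEquivTorus k n).symm ⁻¹' A)).card ≤ 2 * (gridBoundary A).ncard := by
  classical
  set φ := gridEquivTorus k n with hφ
  set B := torusBoundary (φ.symm ⁻¹' A) with hB
  set N := B.filter fun q => (q.2 q.1).val + 1 < k with hN
  set W := B.filter fun q => ¬ (q.2 q.1).val + 1 < k with hW
  have hcard : N.card + W.card = B.card := card_filter_add_card_filter_not _
  have hWN : W.card ≤ N.card := by
    have hex : ∀ q ∈ W, ∃ c : ZMod k, (q.1, q.2 + Pi.single q.1 c) ∈ N := by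
      intro q hq
      rw [hW, mem_filter, hB, mem_torusBoundary] at hq
      obtain ⟨c, hc1, hc2⟩ := exists_boundary_step _ q.1
        (by have := ZMod.val_lt (q.2 q.1); omega) hq.1
      exact ⟨c, mem_filter.2 ⟨mem_torusBoundary.2 hc2, hc1⟩⟩
    choose! c hc using hex
    refine card_le_card_of_injOn (fun q => (q.1, q.2 + Pi.single q.1 (c q)))
      (fun q hq => hc q hq) ?_
    rintro ⟨j, x⟩ hq ⟨j', x'⟩ hq' h
    simp only [Prod.mk.injEq] at h
    obtain ⟨rfl, h⟩ := h
    refine Prod.ext rfl (funext fun i => ?_)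
    rcases eq_or_ne i j with rfl | hi
    · have h1 := (mem_filter.1 hq).2
      have h2 := (mem_filter.1 hq').2
      have h3 := ZMod.val_lt (x i)
      have h4 := ZMod.val_lt (x' i)
      simp only at h1 h2 ⊢
      exact ZMod.val_injective k (by omega)
    · have := congrFun h i
      simpa [Pi.single_eq_of_ne hi] using this
  have hstep : ∀ q ∈ N, ∑ i, ((q.2 + Pi.single q.1 1 : Fin n → ZMod k) i).val =
      ∑ i, (q.2 i).val + 1 := by
    rintro ⟨j, x⟩ hq
    have h1 := (mem_filter.1 hq).2
    simp only at h1 ⊢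
    rw [← add_sum_erase _ _ (mem_univ j), ← add_sum_erase univ (fun i => (x i).val) (mem_univ j),
      Pi.add_apply, Pi.single_eq_same, val_add_one h1]
    rw [sum_congr rfl fun i hi => by rw [Pi.add_apply, Pi.single_eq_of_ne (ne_of_mem_erase hi),
      add_zero]]
    ring
  have hNA : N.card ≤ (gridBoundary A).ncard := by
    rw [← Set.ncard_coe_finset]
    refine Set.ncard_le_ncard_of_injOn
      (fun q => s(φ.symm q.2, φ.symm (q.2 + Pi.single q.1 1))) ?_ ?_ (Set.toFinite _)
    · rintro ⟨j, x⟩ hq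
      obtain ⟨h1, h2⟩ := mem_filter.1 hq
      rw [hB, mem_torusBoundary] at h1
      simp only [Set.mem_preimage] at h1 h2 ⊢
      have hadj : (gridGraph k n).Adj (φ.symm x) (φ.symm (x + Pi.single j 1)) := by
        refine ⟨j, ?_, fun i hi => Fin.ext ?_⟩
        · rw [hφ, gridEquivTorus_symm_apply, gridEquivTorus_symm_apply, Pi.add_apply,
            Pi.single_eq_same, val_add_one h2]
          push_cast
          norm_num
        · rw [hφ, gridEquivTorus_symm_apply, gridEquivTorus_symm_apply, Pi.add_apply,
            Pi.single_eq_of_ne hi, add_zero]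
      by_cases hx : φ.symm x ∈ A
      · exact ⟨_, hx, _, fun h => h1 (by simp [hx, h]), hadj, rfl⟩
      · exact ⟨_, by by_contra h; exact h1 (by simp [hx, h]), _, hx, hadj.symm, Sym2.eq_swap⟩
    · rintro ⟨j, x⟩ hq ⟨j', x'⟩ hq' h
      have s1 := hstep _ hq
      have s2 := hstep _ hq'
      simp only [Sym2.eq_iff, φ.symm.injective.eq_iff] at h s1 s2
      rcases h with ⟨rfl, h⟩ | ⟨h1, h2⟩
      · by_cases hj : j = j'
        · rw [hj]
        · exfalso
          have h1 := congrFun (add_left_cancel h) j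
          rw [Pi.single_eq_same, Pi.single_eq_of_ne hj] at h1
          have h3 := (mem_filter.1 hq).2
          have : Fact (1 < k) := ⟨by omega⟩
          exact one_ne_zero h1
      · rw [h2] at s1
        rw [← h1] at s2
        omega
  omega

end Boundary

/-! ### The junta theorem for the grid -/

section GridJunta

variable {k n : ℕ} [NeZero k]

theorem gridL1Norm_eq_expect (h : (Fin n → Fin k) → ℝ) :
    gridL1Norm h = 𝔼 x, |h ((gridEquivTorus k n).symm x)| := by
  rw [gridL1Norm, Fintype.expect_eq_sum_div_card,
    Equiv.sum_comp (gridEquivTorus k n).symm fun y => |h y|]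
  simp only [Fintype.card_pi, ZMod.card, prod_const, card_univ, Fintype.card_fin, Nat.cast_pow]
  ring

theorem DependsOn.comp_gridEquivTorus {β : Type*} {g : (Fin n → ZMod k) → β} {J : Set (Fin n)}
    (hg : DependsOn g J) : DependsOn (fun x => g (gridEquivTorus k n x)) J :=
  fun x y h => hg fun i hi => by rw [gridEquivTorus_apply, gridEquivTorus_apply, h i hi]

theorem DependsOn.comp_gridEquivTorus_symm {β : Type*} {g : (Fin n → Fin k) → β}
    {J : Set (Fin n)} (hg : DependsOn g J) :
    DependsOn (fun x => g ((gridEquivTorus k n).symm x)) J :=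
  fun x y h => hg fun i hi => Fin.ext (by
    rw [gridEquivTorus_symm_apply, gridEquivTorus_symm_apply, h i hi])

theorem sum_stepVariation_indicator (p : Set (Fin n → ZMod k)) :
    ∑ j, stepVariation j (p.indicator (1 : (Fin n → ZMod k) → ℝ)) =
      (torusBoundary p).card / (k : ℝ) ^ n := by
  classical
  have h : ((torusBoundary p).card : ℝ) = ∑ j : Fin n, ∑ x : Fin n → ZMod k,
      |p.indicator (1 : (Fin n → ZMod k) → ℝ) x - p.indicator 1 (x + Pi.single j 1)| := by
    rw [torusBoundary, card_filter, Nat.cast_sum, Fintype.sum_prod_type]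
    refine sum_congr rfl fun j _ => sum_congr rfl fun x _ => ?_
    by_cases h1 : x ∈ p <;> by_cases h2 : x + Pi.single j 1 ∈ p <;> simp [h1, h2]
  rw [h, sum_div]
  refine sum_congr rfl fun j _ => ?_
  rw [stepVariation, Fintype.expect_eq_sum_div_card]
  simp only [Fintype.card_pi, ZMod.card, prod_const, card_univ, Fintype.card_fin, Nat.cast_pow]

theorem isGridJuntaConstant_thirtySix : IsGridJuntaConstant 36 := by
  intro k n _ _ A ε hε
  classical
  have hk : (0 : ℝ) < k := by exact_mod_cast NeZero.pos k
  rcases le_or_gt 1 ε with h1 | h1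
  · refine ⟨0, fun _ => 0, fun _ => Or.inl rfl, ⟨∅, rfl, fun _ _ _ => rfl⟩, ?_, ?_⟩
    · rw [gridL1Norm_eq_expect]
      refine (expect_le univ_nonempty fun x _ => ?_).trans h1
      by_cases hx : (gridEquivTorus k n).symm x ∈ A <;> simp [hx]
    · rw [Nat.cast_zero]; exact (Real.exp_pos _).le
  set p : Set (Fin n → ZMod k) := (gridEquivTorus k n).symm ⁻¹' A with hp
  have hf : ∀ x, p.indicator (1 : (Fin n → ZMod k) → ℝ) x = 0 ∨ p.indicator 1 x = (1 : ℝ) :=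
    fun x => by by_cases hx : x ∈ p <;> simp [hx]
  have ha : ∑ j, k * stepVariation j (p.indicator (1 : (Fin n → ZMod k) → ℝ)) ≤
      2 * (gridBoundary A).ncard / (k : ℝ) ^ (n - 1) := by
    rw [← mul_sum, sum_stepVariation_indicator]
    have h2 : ((torusBoundary p).card : ℝ) ≤ 2 * (gridBoundary A).ncard := by
      exact_mod_cast torusBoundary_card_le A
    have h3 : (k : ℝ) ^ n = k * k ^ (n - 1) := by
      rw [← pow_succ', Nat.sub_add_cancel (NeZero.pos n)]
    rw [h3, ← mul_div_assoc, mul_div_mul_left _ _ hk.ne']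
    gcongr
  obtain ⟨J, g, hg, hgJ, hd, hc⟩ := exists_torus_junta hf ha hε h1.le
  refine ⟨J.card, fun x => g (gridEquivTorus k n x), fun x => hg _,
    ⟨J, rfl, hgJ.comp_gridEquivTorus⟩, ?_, hc.trans (le_of_eq ?_)⟩
  · rw [gridL1Norm_eq_expect]
    refine le_of_eq_of_le (expect_congr rfl fun x _ => ?_) hd
    simp only [Equiv.apply_symm_apply]
    rfl
  · congr 1
    field_simp
    ring

theorem IsGridJuntaConstant.nonneg {C : ℝ} (hC : IsGridJuntaConstant C) : 0 ≤ C := by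
  by_contra! hneg
  set A : Set (Fin 1 → Fin 2) := {x | x 0 = 0} with hA
  obtain ⟨M, g, -, ⟨J, hJ, hgJ⟩, hd, hM⟩ := hC 2 1 A (1 / 4) (by norm_num)
  have hN : 0 < (gridBoundary A).ncard := by
    rw [Set.ncard_pos (Set.toFinite _)]
    refine ⟨s(fun _ => 0, fun _ => 1), fun _ => 0, by simp [hA], fun _ => 1, by simp [hA],
      ⟨0, by simp, fun i hi => absurd (Subsingleton.elim i 0) hi⟩, rfl⟩
  have hM1 : (M : ℝ) < 1 := by
    refine hM.trans_lt (Real.exp_lt_one_iff.2 ?_)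
    have : (0 : ℝ) < (gridBoundary A).ncard := by exact_mod_cast hN
    exact div_neg_of_neg_of_pos (mul_neg_of_neg_of_pos hneg this) (by norm_num)
  have hM0 : M = 0 := by
    have : M < 1 := by exact_mod_cast hM1
    omega
  have hJ0 : J = ∅ := by rwa [hM0, card_eq_zero] at hJ
  have hconst : g (fun _ => 0) = g (fun _ => 1) := hgJ fun i hi => by simp [hJ0] at hi
  have hsum : ∑ x : Fin 1 → Fin 2, |A.indicator 1 x - g x| =
      |1 - g (fun _ => 0)| + |0 - g (fun _ => 1)| := by
    rw [← Equiv.sum_comp (Equiv.funUnique (Fin 1) (Fin 2)).symm, Fin.sum_univ_two]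
    congr 3 <;> first | rfl | (simp [hA, Set.indicator]; try rfl)
  have h1 : 1 ≤ |1 - g (fun _ => 0)| + |0 - g (fun _ => 1)| := by
    rw [← hconst, zero_sub, abs_neg]
    have := abs_add_le (1 - g fun _ => 0) (g fun _ => 0)
    simpa using this
  rw [gridL1Norm, hsum] at hd
  norm_num at hd h1
  linarith

end GridJunta

/-! ### Arcs of the cycle -/

section Arcs

variable {l : ℕ}

theorem cyclicAbs_zero : cyclicAbs (0 : ZMod l) = 0 := by simp [cyclicAbs]

variable [NeZero l]

theorem cyclicAbs_eq_zero {a : ZMod l} (h : cyclicAbs a = 0) : a = 0 := by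
  have h1 := ZMod.val_lt a
  have : a.val = 0 := by unfold cyclicAbs at h; omega
  exact (ZMod.val_eq_zero a).1 this

theorem card_arc_change {d : ZMod l} (hd : d.val ≤ l / 2) :
    #{u : ZMod l | ¬ (u.val < l / 2 ↔ (u + d).val < l / 2)} = 2 * d.val := by
  have h1 : #{u : ZMod l | ¬ (u.val < l / 2 ↔ (u + d).val < l / 2)} =
      #{a ∈ range l | ¬ (a < l / 2 ↔ (a + d.val) % l < l / 2)} := by
    refine card_bij (fun u _ => u.val) ?_ ?_ ?_
    · intro u hu
      rw [mem_filter] at hu ⊢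
      exact ⟨mem_range.2 (ZMod.val_lt u), by rw [← ZMod.val_add]; exact hu.2⟩
    · intro u _ v _ h
      exact ZMod.val_injective l h
    · intro a ha
      rw [mem_filter, mem_range] at ha
      have hv : ((a : ℕ) : ZMod l).val = a := by
        rw [ZMod.val_natCast, Nat.mod_eq_of_lt ha.1]
      refine ⟨(a : ZMod l), mem_filter.2 ⟨mem_univ _, ?_⟩, hv⟩
      rw [ZMod.val_add, hv]
      exact ha.2
  have h2 : {a ∈ range l | ¬ (a < l / 2 ↔ (a + d.val) % l < l / 2)} =
      Ico (l / 2 - d.val) (l / 2) ∪ Ico (l - d.val) l := by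
    ext a
    simp only [mem_filter, mem_range, mem_union, mem_Ico]
    by_cases hal : a < l
    · rcases lt_or_ge (a + d.val) l with h | h
      · rw [Nat.mod_eq_of_lt h]; omega
      · rw [Nat.mod_eq_sub_mod h, Nat.mod_eq_of_lt (by omega)]; omega
    · omega
  rw [h1, h2, card_union_of_disjoint, Nat.card_Ico, Nat.card_Ico]
  · omega
  · rw [disjoint_left]
    intro a
    simp only [mem_Ico]
    omega

/-- Half-circles separate two points of the cycle in proportion to their distance. -/
theorem card_arc_separating (v w : ZMod l) :
    #{t : ZMod l | ¬ ((v - t).val < l / 2 ↔ (w - t).val < l / 2)} = 2 * cyclicAbs (v - w) := by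
  have key : ∀ v w : ZMod l, (w - v).val ≤ l / 2 →
      #{t : ZMod l | ¬ ((v - t).val < l / 2 ↔ (w - t).val < l / 2)} = 2 * (w - v).val := by
    intro v w h
    rw [← card_arc_change h]
    refine card_equiv (Equiv.subLeft v) fun t => ?_
    simp only [mem_filter, mem_univ, true_and, Equiv.subLeft_apply]
    rw [show v - t + (w - v) = w - t by ring]
  have h1 := ZMod.val_lt (v - w)
  rcases le_or_gt (v - w).val (l / 2) with h | h
  · rw [show cyclicAbs (v - w) = (v - w).val by unfold cyclicAbs; omega, ← key w v h]
    simp only [iff_comm]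
  · have h2 : (w - v).val = l - (v - w).val := by
      rw [← neg_sub v w, ZMod.neg_val, if_neg]
      intro h0
      rw [h0, ZMod.val_zero] at h
      omega
    rw [key v w (by omega), h2]
    unfold cyclicAbs
    omega

/-- The indicator function of the half-circle starting at `t`. -/
noncomputable def arcIndicator (v t : ZMod l) : ℝ := if (v - t).val < l / 2 then 1 else 0

theorem sum_abs_arcIndicator_sub (v w : ZMod l) :
    ∑ t, |arcIndicator v t - arcIndicator w t| = 2 * cyclicAbs (v - w) := by
  have h := card_arc_separating v w
  rw [card_filter] at h
  have h' := congrArg (Nat.cast : ℕ → ℝ) h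
  push_cast at h'
  rw [← h']
  refine sum_congr rfl fun t _ => ?_
  unfold arcIndicator
  by_cases h1 : (v - t).val < l / 2 <;> by_cases h2 : (w - t).val < l / 2 <;> simp [h1, h2]

/-- Every family of approximate arc indicators can be decoded. -/
theorem exists_decode (l : ℕ) [NeZero l] : ∃ dec : (ZMod l → ℝ) → ZMod l, ∀ z v,
    (cyclicAbs (v - dec z) : ℝ) ≤ ∑ t, |arcIndicator v t - z t| := by
  have h : ∀ z : ZMod l → ℝ, ∃ w, ∀ v, ∑ t, |arcIndicator w t - z t| ≤
      ∑ t, |arcIndicator v t - z t| := fun z => by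
    obtain ⟨w, -, hw⟩ := exists_min_image univ
      (fun w => ∑ t, |arcIndicator w t - z t|) univ_nonempty
    exact ⟨w, fun v => hw v (mem_univ v)⟩
  choose dec hdec using h
  refine ⟨dec, fun z v => ?_⟩
  have h1 : ∑ t, |arcIndicator v t - arcIndicator (dec z) t| ≤
      ∑ t, |arcIndicator v t - z t| + ∑ t, |arcIndicator (dec z) t - z t| := by
    rw [← sum_add_distrib]
    refine sum_le_sum fun t _ => ?_
    rw [abs_sub_comm (arcIndicator (dec z) t)]
    exact abs_sub_le _ _ _
  rw [sum_abs_arcIndicator_sub] at h1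
  have := hdec z v
  linarith

end Arcs

/-! ### Lipschitz maps between tori -/

section Lipschitz

variable {k l n : ℕ} [NeZero k] [NeZero l]

/-- The total variation of a map from the torus to a cycle, along coordinate steps. -/
noncomputable def cyclicVariation (f : (Fin n → ZMod k) → ZMod l) : ℝ :=
  ∑ q : Fin n × (Fin n → ZMod k), (cyclicAbs (f q.2 - f (q.2 + Pi.single q.1 1)) : ℝ)

/-- The points of the grid which a map to a cycle sends to the half-circle starting at `t`. -/
def gridArcPreimage (f : (Fin n → ZMod k) → ZMod l) (t : ZMod l) : Set (Fin n → Fin k) :=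
  {y | (f (gridEquivTorus k n y) - t).val < l / 2}

theorem sum_gridBoundary_gridArcPreimage_le (f : (Fin n → ZMod k) → ZMod l) :
    ∑ t, ((gridBoundary (gridArcPreimage f t)).ncard : ℝ) ≤ 2 * cyclicVariation f := by
  classical
  have h1 : ∑ t, (gridBoundary (gridArcPreimage f t)).ncard ≤
      ∑ q : Fin n × (Fin n → ZMod k), 2 * cyclicAbs (f q.2 - f (q.2 + Pi.single q.1 1)) := by
    calc _ ≤ ∑ t, (torusBoundary ((gridEquivTorus k n).symm ⁻¹' gridArcPreimage f t)).card :=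
          sum_le_sum fun t _ => gridBoundary_ncard_le _
      _ = ∑ q : Fin n × (Fin n → ZMod k), #{t : ZMod l | ¬ ((f q.2 - t).val < l / 2 ↔
            (f (q.2 + Pi.single q.1 1) - t).val < l / 2)} := by
          simp only [torusBoundary, card_filter]
          rw [sum_comm]
          simp only [gridArcPreimage, Set.mem_preimage, Set.mem_ofPred_eq, Equiv.apply_symm_apply]
      _ = _ := sum_congr rfl fun q _ => card_arc_separating _ _
  rw [cyclicVariation, mul_sum]
  exact_mod_cast h1

theorem IsGridJuntaConstant.exists_cyclic_junta {C : ℝ} (hC : IsGridJuntaConstant C) [NeZero n]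
    (f : (Fin n → ZMod k) → ZMod l) {β ε : ℝ} (hβ : 0 < β) (hε : 0 < ε)
    (hf : cyclicVariation f ≤ (k : ℝ) ^ n * β) :
    ∃ (J : Finset (Fin n)) (g : (Fin n → ZMod k) → ZMod l), DependsOn g (J : Set (Fin n)) ∧
      (J.card : ℝ) ≤ l * Real.exp (4 * C * β * k / ε) ∧ cyclicL1Dist f g ≤ ε := by
  classical
  have hk : (0 : ℝ) < k := by exact_mod_cast NeZero.pos k
  have hl : (0 : ℝ) < l := by exact_mod_cast NeZero.pos l
  have hC0 := hC.nonneg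
  set B : ZMod l → ℝ := fun t => ((gridBoundary (gridArcPreimage f t)).ncard : ℝ) with hB
  have hB0 : ∀ t, 0 ≤ B t := fun t => Nat.cast_nonneg _
  have hsumB : ∑ t, B t ≤ 2 * ((k : ℝ) ^ n * β) :=
    (sum_gridBoundary_gridArcPreimage_le f).trans (by linarith)
  set η : ZMod l → ℝ := fun t => if B t = 0 then ε / (2 * l) else ε * B t / (4 * β * k ^ n)
    with hη
  have hη0 : ∀ t, 0 < η t := fun t => by
    simp only [hη]
    split_ifs with h
    · positivity
    · have := (hB0 t).lt_of_ne' h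
      positivity
  have hηsum : ∑ t, η t ≤ ε := by
    calc ∑ t, η t ≤ ∑ t, (ε / (2 * l) + ε / (4 * β * k ^ n) * B t) := by
          refine sum_le_sum fun t _ => ?_
          simp only [hη]
          split_ifs with h
          · rw [h, mul_zero, add_zero]
          · rw [div_mul_eq_mul_div]
            exact le_add_of_nonneg_left (by positivity)
      _ = ε / 2 + ε / (4 * β * k ^ n) * ∑ t, B t := by
          rw [sum_add_distrib, ← mul_sum, sum_const, card_univ, ZMod.card, nsmul_eq_mul]
          field_simp
      _ ≤ ε / 2 + ε / (4 * β * k ^ n) * (2 * ((k : ℝ) ^ n * β)) := by gcongr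
      _ = ε := by field_simp; ring
  choose M g hg hJ hd hM using fun t => hC k n (gridArcPreimage f t) (η t) (hη0 t)
  choose J hJM hgJ using hJ
  have hM' : ∀ t, (M t : ℝ) ≤ Real.exp (4 * C * β * k / ε) := by
    intro t
    refine (hM t).trans (Real.exp_le_exp.2 ?_)
    change C * B t / (k ^ (n - 1) * η t) ≤ _
    by_cases h : B t = 0
    · rw [h, mul_zero, zero_div]
      positivity
    · have hkn : (k : ℝ) ^ n = k * k ^ (n - 1) := by
        rw [← pow_succ', Nat.sub_add_cancel (NeZero.pos n)]
      simp only [hη, if_neg h]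
      rw [hkn]
      refine le_of_eq ?_
      field_simp
  obtain ⟨dec, hdec⟩ := exists_decode l
  refine ⟨univ.biUnion J, fun x => dec fun t => g t ((gridEquivTorus k n).symm x), ?_, ?_, ?_⟩
  · intro x y h
    refine congrArg dec (funext fun t => (hgJ t).comp_gridEquivTorus_symm fun i hi => h i ?_)
    exact mem_coe.2 (mem_biUnion.2 ⟨t, mem_univ t, mem_coe.1 hi⟩)
  · calc ((univ.biUnion J).card : ℝ) ≤ ((∑ t, (J t).card : ℕ) : ℝ) := by
          exact_mod_cast card_biUnion_le
      _ = ∑ t, (M t : ℝ) := by simp only [hJM, Nat.cast_sum]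
      _ ≤ ∑ _t : ZMod l, Real.exp (4 * C * β * k / ε) := sum_le_sum fun t _ => hM' t
      _ = _ := by rw [sum_const, card_univ, ZMod.card, nsmul_eq_mul]
  · refine le_trans ?_ ((sum_le_sum fun t _ => hd t).trans hηsum)
    unfold cyclicL1Dist gridL1Norm
    rw [← mul_sum, sum_comm, ← Equiv.sum_comp (gridEquivTorus k n)]
    refine mul_le_mul_of_nonneg_left (sum_le_sum fun y _ => ?_) (by positivity)
    simp only [Equiv.symm_apply_apply]
    refine (hdec _ _).trans (le_of_eq (sum_congr rfl fun t _ => ?_))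
    by_cases hy : (f (gridEquivTorus k n y) - t).val < l / 2 <;>
      simp [arcIndicator, gridArcPreimage, Set.indicator, hy]

theorem torusNorm_nonneg {k n : ℕ} (x : Fin n → ZMod k) : 0 ≤ torusNorm x := by
  unfold torusNorm
  positivity

theorem torusNorm_single_neg_one_le (j : Fin n) :
    torusNorm (-Pi.single j 1 : Fin n → ZMod k) ≤ 1 / n := by
  have h1 : ∑ i, cyclicAbs ((-Pi.single j 1 : Fin n → ZMod k) i) = cyclicAbs (-1 : ZMod k) := by
    rw [sum_eq_single_of_mem j (mem_univ j)]
    · simp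
    · intro i _ hi
      rw [Pi.neg_apply, Pi.single_eq_of_ne hi, neg_zero, cyclicAbs_zero]
  have h2 : cyclicAbs (-1 : ZMod k) ≤ 1 := by
    have hv : (-1 : ZMod k).val + 1 = k := by
      obtain ⟨m, rfl⟩ := Nat.exists_eq_succ_of_ne_zero (NeZero.ne k)
      rw [ZMod.val_neg_one]
    unfold cyclicAbs
    omega
  have h3 : ∑ i, (cyclicAbs ((-Pi.single j 1 : Fin n → ZMod k) i) : ℝ) ≤ 1 := by
    rw [← Nat.cast_sum, h1]
    exact_mod_cast h2
  unfold torusNorm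
  exact mul_le_of_le_one_right (by positivity) h3

theorem eq_of_torusNorm_sub_le_zero {x y : Fin n → ZMod l} (h : torusNorm (x - y) ≤ 0) :
    x = y := by
  rcases Nat.eq_zero_or_pos n with rfl | hn
  · exact Subsingleton.elim _ _
  have hn' : (0 : ℝ) < n := by exact_mod_cast hn
  have h0 := le_antisymm h (torusNorm_nonneg _)
  unfold torusNorm at h0
  have h1 := (mul_eq_zero.1 h0).resolve_left (by positivity)
  rw [sum_eq_zero_iff_of_nonneg fun _ _ => Nat.cast_nonneg _] at h1
  funext i
  exact sub_eq_zero.1 (cyclicAbs_eq_zero (by exact_mod_cast h1 i (mem_univ i)))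

theorem IsTorusLipschitz.sum_cyclicVariation_le {k l n m : ℕ} [NeZero k] [NeZero n] {α : ℝ}
    {f : (Fin n → ZMod k) → (Fin m → ZMod l)} (hf : IsTorusLipschitz α f) (hα : 0 ≤ α) :
    ∑ i, cyclicVariation (fun x => f x i) ≤ (k : ℝ) ^ n * α * m := by
  have hn : (0 : ℝ) < n := by exact_mod_cast NeZero.pos n
  rcases Nat.eq_zero_or_pos m with rfl | hm
  · simp
  have hm' : (0 : ℝ) < m := by exact_mod_cast hm
  have h1 : ∀ q : Fin n × (Fin n → ZMod k),
      ∑ i, (cyclicAbs (f q.2 i - f (q.2 + Pi.single q.1 1) i) : ℝ) ≤ α * m / n := by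
    intro q
    have h2 := hf q.2 (q.2 + Pi.single q.1 1)
    rw [sub_add_cancel_left] at h2
    have h3 := h2.trans (mul_le_mul_of_nonneg_left (torusNorm_single_neg_one_le q.1) hα)
    unfold torusNorm at h3
    rw [one_div, inv_mul_le_iff₀ hm'] at h3
    refine h3.trans (le_of_eq ?_)
    field_simp
  unfold cyclicVariation
  rw [sum_comm]
  refine (sum_le_sum fun q _ => h1 q).trans (le_of_eq ?_)
  rw [sum_const, card_univ, Fintype.card_prod, Fintype.card_pi, nsmul_eq_mul]
  simp only [ZMod.card, prod_const, card_univ, Fintype.card_fin]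
  push_cast
  field_simp

theorem IsJunta.of_card_le {X Y : Type*} {g : (Fin n → X) → Y} {J : Finset (Fin n)}
    (hg : DependsOn g (J : Set (Fin n))) {M : ℕ} (h1 : J.card ≤ M) (h2 : M ≤ n) :
    IsJunta M g := by
  obtain ⟨J', hJ', hc⟩ := exists_superset_card_eq h1 (by simpa using h2)
  exact ⟨J', hc, fun x y h => hg fun i hi => h i (hJ' hi)⟩

theorem IsTorusLipschitzConstant.of_isGridJuntaConstant {C : ℝ} (hC : IsGridJuntaConstant C) :
    IsTorusLipschitzConstant (4 * C) := by
  classical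
  intro k l n m _ _ α f hf δ ε hδ hε
  by_cases hconst : ∀ x y, f x = f y
  · refine ⟨0, by rw [Nat.cast_zero]; positivity, ?_⟩
    have huniv : {i : Fin m | ∃ g : (Fin n → ZMod k) → ZMod l,
        IsJunta 0 g ∧ cyclicL1Dist (fun x => f x i) g ≤ ε} = Set.univ := by
      refine Set.eq_univ_of_forall fun i => ⟨fun x => f x i,
        ⟨∅, rfl, fun x y _ => congrFun (hconst x y) i⟩, ?_⟩
      simp [cyclicL1Dist, cyclicAbs_zero, hε.le]
    rw [huniv, Set.ncard_univ, Nat.card_fin]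
    nlinarith [(Nat.cast_nonneg m : (0 : ℝ) ≤ m)]
  have hα : 0 < α := by
    by_contra! hα
    refine hconst fun x y => eq_of_torusNorm_sub_le_zero ((hf x y).trans ?_)
    exact mul_nonpos_of_nonpos_of_nonneg hα (torusNorm_nonneg _)
  have hn : NeZero n := ⟨fun h => by
    subst h
    exact hconst fun x y => congrArg f (Subsingleton.elim x y)⟩
  have hkn : (0 : ℝ) < (k : ℝ) ^ n := pow_pos (by exact_mod_cast NeZero.pos k) n
  have hβ : 0 < α / δ := by positivity
  set bound := l * Real.exp (4 * C * α * k / (δ * ε)) with hbound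
  have hbound0 : 0 ≤ bound := by positivity
  refine ⟨min n ⌊bound⌋₊, ?_, ?_⟩
  · exact (Nat.cast_le.2 (min_le_right _ _)).trans (Nat.floor_le hbound0)
  set good : Finset (Fin m) := {i | cyclicVariation (fun x => f x i) ≤ (k : ℝ) ^ n * (α / δ)}
    with hgood
  set bad : Finset (Fin m) := {i | ¬ cyclicVariation (fun x => f x i) ≤ (k : ℝ) ^ n * (α / δ)}
    with hbad
  have hcard : (good.card : ℝ) + bad.card = m := by
    have := card_filter_add_card_filter_not (s := (univ : Finset (Fin m)))
      (fun i => cyclicVariation (fun x => f x i) ≤ (k : ℝ) ^ n * (α / δ))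
    rw [card_univ, Fintype.card_fin] at this
    rw [← Nat.cast_add, hgood, hbad, this]
  have hbadcard : (bad.card : ℝ) ≤ δ * m := by
    have h1 : bad.card * ((k : ℝ) ^ n * (α / δ)) ≤ (δ * m) * ((k : ℝ) ^ n * (α / δ)) := by
      calc bad.card * ((k : ℝ) ^ n * (α / δ)) = ∑ _i ∈ bad, (k : ℝ) ^ n * (α / δ) := by
            rw [sum_const, nsmul_eq_mul]
        _ ≤ ∑ i ∈ bad, cyclicVariation (fun x => f x i) :=
            sum_le_sum fun i hi => (not_le.1 (mem_filter.1 hi).2).le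
        _ ≤ ∑ i, cyclicVariation (fun x => f x i) :=
            sum_le_sum_of_subset_of_nonneg (subset_univ _) fun _ _ _ =>
              sum_nonneg fun _ _ => Nat.cast_nonneg _
        _ ≤ (k : ℝ) ^ n * α * m := hf.sum_cyclicVariation_le hα.le
        _ = _ := by field_simp
    exact le_of_mul_le_mul_right h1 (by positivity)
  calc (1 - δ) * (m : ℝ) ≤ good.card := by linarith
    _ ≤ _ := by
      rw [← Set.ncard_coe_finset]
      refine Nat.cast_le.2 (Set.ncard_le_ncard (fun i hi => ?_) (Set.toFinite _))
      obtain ⟨J, g, hg, hJ, hd⟩ := hC.exists_cyclic_junta (fun x => f x i) hβ hε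
        (mem_filter.1 (mem_coe.1 hi)).2
      refine ⟨g, IsJunta.of_card_le hg (le_min ?_ (Nat.le_floor ?_)) (min_le_left _ _), hd⟩
      · simpa using card_le_univ J
      · refine hJ.trans (le_of_eq ?_)
        rw [hbound]
        congr 2
        field_simp

end Lipschitz

theorem theorem1p7 :
    (∃ C₂ : ℝ, 0 < C₂ ∧ IsTorusLipschitzConstant C₂) ∧
      ∀ C₁ : ℝ, IsGridJuntaConstant C₁ → IsTorusLipschitzConstant (4 * C₁) :=
  ⟨⟨4 * 36, by norm_num, .of_isGridJuntaConstant isGridJuntaConstant_thirtySix⟩,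
    fun _ hC => .of_isGridJuntaConstant hC⟩
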